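/- Let $\mathcal G$ be an étale groupoid with compact Hausdorff unit space $\mathcal G^{(0)}$ (that is, a topological groupoid whose source and range maps $s, r$ are local homeomorphisms; $\mathcal G$ itself need not be Hausdorff). A \emph{compact $\mathcal G$-space} is a compact Hausdorff space $Y$ with a continuous surjection $p : Y \to \mathcal G^{(0)}$ and a continuous action map $\{(g,y) \in \mathcal G \times Y : s(g) = p(y)\} \to Y$, $(g,y) \mapsto gy$, such that $p(gy) = r(g)$, $(gh)y = g(hy)$ and units act trivially. A \emph{$\mathcal G$-map} is a continuous map between compact $\mathcal G$-spaces that commutes with the projections to $\mathcal G^{(0)}$ and with the actions. Let $\mathcal P(Y)$ be the space of regular Borel probability measures on $Y$ with the weak* topology, and regard $Y \subseteq \mathcal P(Y)$ through Dirac measures. If $\mu \in \mathcal P(Y)$ satisfies $p_*\mu = \delta_{s(g)}$, let $g\mu \in \mathcal P(Y)$ be given by $\int f \, d(g\mu) = \int_{p^{-1}(s(g))} f(gy) \, d\mu(y)$ for $f \in C(Y)$. For $A \subseteq \mathcal P(Y)$ put $\mathcal G \cdot A = \{ g\mu : g \in \mathcal G,\ \mu \in A,\ p_*\mu = \delta_{s(g)}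 \}$. The compact $\mathcal G$-space $Y$ is - \emph{irreducible} if every closed $\mathcal G$-invariant set $Z \subseteq Y$ with $p(Z) = \mathcal G^{(0)}$ equals $Y$; - \emph{strongly proximal} if for every family $(\mu_x)_{x \in \mathcal G^{(0)}}$ in $\mathcal P(Y)$ with $p_*\mu_x = \delta_x$ for all $x$ one has $\mathcal G^{(0)} \subseteq p\bigl(Y \cap \overline{\mathcal G \cdot \{\mu_x : x \in \mathcal G^{(0)}\}}\bigr)$; - a \emph{$\mathcal G$-boundary} if it is irreducible and strongly proximal. **Theorem.** There is a $\mathcal G$-boundary $\partial_F \mathcal G$ that is universal in the sense that for every $\mathcal G$-boundary $Y$ there is a $\mathcal G$-map $\partial_F \mathcal G \to Y$; every such $\mathcal G$-map is surjective. Furthermore, $\partial_F \mathcal G$ is the unique $\mathcal G$-boundary with this universal property up to isomorphism of $\mathcal G$-spaces. -/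

import Mathlib

open CategoryTheory MeasureTheory Set

universe u v w w'

namespace FurstenbergBoundary

/-- The set of all arrows of a groupoid `G` with object set `X`. -/
@[ext]
structure Arr (X : Type u) [Groupoid.{v} X] where
  src : X
  tgt : X
  hom : src ⟶ tgt

namespace Arr

variable {X : Type u} [Groupoid.{v} X]

/-- The unit at `x`. -/
def unit (x : X) : Arr X := ⟨x, x, 𝟙 x⟩

/-- The inverse of an arrow. -/
def inv (g : Arr X) : Arr X := ⟨g.tgt, g.src, Groupoid.inv g.hom⟩

/-- The product `g · h` (first `h`, then `g`), defined when `s(g) = r(h)`. -/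
def mul (g h : Arr X) (e : g.src = h.tgt) : Arr X :=
  ⟨h.src, g.tgt, h.hom ≫ eqToHom e.symm ≫ g.hom⟩

end Arr

/-- An étale groupoid with unit space `X`: a topological groupoid (topologies on the set of units
and on the set of arrows for which all structure maps are continuous) whose source and range maps
are local homeomorphisms. Since `unit` is a continuous section of the continuous source map, it
is a homeomorphism of `X` onto the set of units with the subspace topology. The space of arrows
is not required to be Hausdorff. -/
class IsEtaleGroupoid (X : Type u) [TopologicalSpace X] [Groupoid.{v} X]
    [TopologicalSpace (Arr X)] : Prop where
  continuous_unit : Continuous (Arr.unit : X → Arr X)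
  continuous_inv : Continuous (Arr.inv : Arr X → Arr X)
  continuous_mul : Continuous fun q : {q : Arr X × Arr X // q.1.src = q.2.tgt} =>
    Arr.mul q.1.1 q.1.2 q.2
  isLocalHomeomorph_src : IsLocalHomeomorph (Arr.src : Arr X → X)
  isLocalHomeomorph_tgt : IsLocalHomeomorph (Arr.tgt : Arr X → X)

/-- A compact (Hausdorff) `G`-space: a compact Hausdorff space with a continuous surjection `p`
onto the unit space and a continuous action `(g, y) ↦ g y`, defined when `s(g) = p(y)`. -/
structure CompactGSpace (X : Type u) [TopologicalSpace X] [Groupoid.{v} X]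
    [TopologicalSpace (Arr X)] where
  carrier : Type w
  [topology : TopologicalSpace carrier]
  [compact : CompactSpace carrier]
  [t2 : T2Space carrier]
  p : carrier → X
  continuous_p : Continuous p
  surjective_p : Function.Surjective p
  act : (g : Arr X) → (y : carrier) → g.src = p y → carrier
  p_act : ∀ g y h, p (act g y h) = g.tgt
  unit_act : ∀ y, act (Arr.unit (p y)) y rfl = y
  mul_act : ∀ (g h : Arr X) (e : g.src = h.tgt) (y : carrier) (hy : h.src = p y),
    act (Arr.mul g h e) y hy = act g (act h y hy) (e.trans (p_act h y hy).symm)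
  continuous_act : Continuous fun q : {q : Arr X × carrier // q.1.src = p q.2} =>
    act q.1.1 q.1.2 q.2

namespace CompactGSpace

variable {X : Type u} [TopologicalSpace X] [Groupoid.{v} X] [TopologicalSpace (Arr X)]

instance : CoeSort (CompactGSpace.{u, v, w} X) (Type w) := ⟨carrier⟩

instance (Y : CompactGSpace.{u, v, w} X) : TopologicalSpace Y := Y.topology
instance (Y : CompactGSpace.{u, v, w} X) : CompactSpace Y := Y.compact
instance (Y : CompactGSpace.{u, v, w} X) : T2Space Y := Y.t2
instance (Y : CompactGSpace.{u, v, w} X) : MeasurableSpace Y := borel Y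
instance (Y : CompactGSpace.{u, v, w} X) : BorelSpace Y := ⟨rfl⟩

/-- Morphisms of `G`-spaces (`G`-maps): continuous equivariant maps over the unit space. -/
structure GMap (Y : CompactGSpace.{u, v, w} X) (Z : CompactGSpace.{u, v, w'} X) where
  toFun : Y → Z
  continuous_toFun : Continuous toFun
  p_toFun : ∀ y, Z.p (toFun y) = Y.p y
  toFun_act : ∀ (g : Arr X) (y : Y) (h : g.src = Y.p y),
    toFun (Y.act g y h) = Z.act g (toFun y) (h.trans (p_toFun y).symm)

/-- Isomorphisms of `G`-spaces: mutually inverse `G`-maps. -/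
structure GIso (Y : CompactGSpace.{u, v, w} X) (Z : CompactGSpace.{u, v, w'} X) where
  hom : GMap Y Z
  inv : GMap Z Y
  left_inv : Function.LeftInverse inv.toFun hom.toFun
  right_inv : Function.RightInverse inv.toFun hom.toFun

/-- `A ⊆ Y` is `G`-invariant. -/
def IsInvariant (Y : CompactGSpace.{u, v, w} X) (A : Set Y) : Prop :=
  ∀ (g : Arr X) (y : Y) (h : g.src = Y.p y), y ∈ A → Y.act g y h ∈ A

/-- `Y` is irreducible: the only closed `G`-invariant subset that projects onto the unit space
is `Y` itself. -/
def IsIrreducible (Y : CompactGSpace.{u, v, w} X) : Prop :=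
  ∀ A : Set Y, IsClosed A → Y.IsInvariant A → Y.p '' A = univ → A = univ

end CompactGSpace

/-- The space `𝒫(Y)` of (regular Borel) probability measures on `Y`. -/
def RegularProb (Y : Type w) [TopologicalSpace Y] [MeasurableSpace Y] : Type w :=
  {μ : ProbabilityMeasure Y // (μ : Measure Y).Regular}

namespace RegularProb

variable {Y : Type w} [TopologicalSpace Y] [MeasurableSpace Y]

/-- The weak* topology: `μ i → μ` iff `∫ f d(μ i) → ∫ f dμ` for every bounded continuous `f`. -/
instance [OpensMeasurableSpace Y] : TopologicalSpace (RegularProb Y) :=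
  inferInstanceAs (TopologicalSpace {μ : ProbabilityMeasure Y // (μ : Measure Y).Regular})

/-- The underlying measure. -/
def toMeasure (μ : RegularProb Y) : Measure Y := (μ.1 : Measure Y)

instance (μ : RegularProb Y) : IsProbabilityMeasure μ.toMeasure :=
  inferInstanceAs (IsProbabilityMeasure (μ.1 : Measure Y))

instance (μ : RegularProb Y) : μ.toMeasure.Regular := μ.2

theorem regular_map_of_continuous {F : Type w'} [TopologicalSpace F] [MeasurableSpace F]
    [BorelSpace F] [T2Space Y] [CompactSpace Y] [BorelSpace Y]
    (m : Measure F) [IsFiniteMeasure m] [m.InnerRegularCompactLTTop] {f : F → Y}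
    (hf : Continuous f) : (m.map f).Regular := by
  have : (m.map f).InnerRegularCompactLTTop :=
    Measure.InnerRegularCompactLTTop.map_of_continuous hf
  infer_instance

/-- The Dirac measure `δ_y`; this embeds `Y` into `𝒫(Y)`. -/
noncomputable def dirac [T2Space Y] [CompactSpace Y] [BorelSpace Y] (y : Y) : RegularProb Y :=
  ⟨diracProba y, by
    have : (Measure.dirac y).Regular := by
      have h := regular_map_of_continuous (Y := Y) (Measure.dirac PUnit.unit.{w + 1})
        (f := fun _ => y) continuous_const
      simpa [Measure.map_const] using h
    exact this⟩

end RegularProb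

namespace CompactGSpace

variable {X : Type u} [TopologicalSpace X] [Groupoid.{v} X] [TopologicalSpace (Arr X)]
/-- The fibre `p⁻¹(s(g))`, on which `g` acts. -/
abbrev SrcFibre (Y : CompactGSpace.{u, v, w} X) (g : Arr X) : Type w := {y : Y // g.src = Y.p y}

/-- The action of the arrow `g` as a map `p⁻¹(s(g)) → Y`. -/
def actFibre (Y : CompactGSpace.{u, v, w} X) (g : Arr X) (y : Y.SrcFibre g) : Y :=
  Y.act g y.1 y.2

theorem continuous_actFibre (Y : CompactGSpace.{u, v, w} X) (g : Arr X) :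
    Continuous (Y.actFibre g) :=
  Y.continuous_act.comp (f := fun y : Y.SrcFibre g =>
    (⟨(g, y.1), y.2⟩ : {q : Arr X × Y // q.1.src = Y.p q.2})) (by fun_prop)

/-- The measure `g μ`: restrict `μ` to the fibre `p⁻¹(s(g))` and push forward along `y ↦ g y`,
so that `∫ f d(g μ) = ∫_{p⁻¹(s(g))} f(g y) dμ(y)`. -/
noncomputable def translateMeasure (Y : CompactGSpace.{u, v, w} X) (g : Arr X) (μ : Measure Y) :
    Measure Y :=
  (μ.comap (Subtype.val : Y.SrcFibre g → Y)).map (Y.actFibre g)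

theorem isClosedEmbedding_fibre [T2Space X] (Y : CompactGSpace.{u, v, w} X) (g : Arr X) :
    Topology.IsClosedEmbedding (Subtype.val : Y.SrcFibre g → Y) :=
  (isClosed_eq continuous_const Y.continuous_p).isClosedEmbedding_subtypeVal

/-- The point mass condition `p_* μ = δ_x`. -/
def LiesOver [MeasurableSpace X] (Y : CompactGSpace.{u, v, w} X) (μ : RegularProb Y) (x : X) :
    Prop :=
  μ.toMeasure.map Y.p = Measure.dirac x

theorem isProbabilityMeasure_translateMeasure [T2Space X] [MeasurableSpace X] [BorelSpace X]
    (Y : CompactGSpace.{u, v, w} X) (g : Arr X) (μ : RegularProb Y) (h : Y.LiesOver μ g.src) :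
    IsProbabilityMeasure (Y.translateMeasure g μ.toMeasure) := by
  have he := (Y.isClosedEmbedding_fibre g).measurableEmbedding
  have hm : μ.toMeasure (Y.p ⁻¹' {g.src}) = 1 := by
    rw [← Measure.map_apply Y.continuous_p.measurable (measurableSet_singleton _), h]
    simp
  refine ⟨?_⟩
  rw [translateMeasure, Measure.map_apply (Y.continuous_actFibre g).measurable MeasurableSet.univ,
    preimage_univ, he.comap_apply, image_univ, Subtype.range_coe_subtype, ← hm]
  congr 1
  ext y
  exact eq_comm

theorem regular_translateMeasure [T2Space X] (Y : CompactGSpace.{u, v, w} X) (g : Arr X)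
    (μ : RegularProb Y) : (Y.translateMeasure g μ.toMeasure).Regular := by
  have he := Y.isClosedEmbedding_fibre g
  have : (μ.toMeasure.comap (Subtype.val : Y.SrcFibre g → Y)).InnerRegular :=
    ⟨(Measure.InnerRegular.innerRegular (μ := μ.toMeasure)).comap he.measurableEmbedding
      (fun _ hU => he.measurableEmbedding.measurableSet_image.mpr hU)
      (fun _ hr hK => he.isInducing.isCompact_preimage' hK hr)⟩
  have : IsFiniteMeasure (μ.toMeasure.comap (Subtype.val : Y.SrcFibre g → Y)) :=
    ⟨by rw [he.measurableEmbedding.comap_apply]; exact measure_lt_top _ _⟩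
  exact RegularProb.regular_map_of_continuous _ (Y.continuous_actFibre g)

variable [T2Space X] [MeasurableSpace X] [BorelSpace X]

/-- The action of the arrow `g` on a probability measure `μ` with `p_* μ = δ_{s(g)}`. -/
noncomputable def translate (Y : CompactGSpace.{u, v, w} X) (g : Arr X) (μ : RegularProb Y)
    (h : Y.LiesOver μ g.src) : RegularProb Y :=
  ⟨⟨Y.translateMeasure g μ.toMeasure, Y.isProbabilityMeasure_translateMeasure g μ h⟩,
    Y.regular_translateMeasure g μ⟩

/-- `G · A = {g μ | μ ∈ A, p_* μ = δ_{s(g)}}` for a set `A` of probability measures on `Y`. -/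
def orbit (Y : CompactGSpace.{u, v, w} X) (A : Set (RegularProb Y)) : Set (RegularProb Y) :=
  {ν | ∃ (g : Arr X) (μ : RegularProb Y) (h : Y.LiesOver μ g.src), μ ∈ A ∧ Y.translate g μ h = ν}

/-- `Y` is strongly proximal: for every family `(μ_x)` of probability measures on `Y` with
`p_* μ_x = δ_x`, the set `Y ∩ closure (G · {μ_x})` projects onto the unit space, where the closure
is taken in the weak* topology and `Y` is embedded in `𝒫(Y)` by Dirac measures. -/
def IsStronglyProximal (Y : CompactGSpace.{u, v, w} X) : Prop :=
  ∀ μ : X → RegularProb Y, (∀ x, Y.LiesOver (μ x) x) →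
    univ ⊆ Y.p '' {y : Y | RegularProb.dirac y ∈ closure (Y.orbit (range μ))}

/-- A `G`-boundary is an irreducible and strongly proximal compact `G`-space. -/
def IsBoundary (Y : CompactGSpace.{u, v, w} X) : Prop :=
  Y.IsIrreducible ∧ Y.IsStronglyProximal

/-- `B` is a `G`-boundary that admits a `G`-map to every `G`-boundary (with underlying set in the
universe `Type w'`). -/
def IsUniversalBoundary (B : CompactGSpace.{u, v, w} X) : Prop :=
  B.IsBoundary ∧ ∀ Y : CompactGSpace.{u, v, w'} X, Y.IsBoundary → Nonempty (GMap B Y)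

end CompactGSpace

end FurstenbergBoundary

-- Call a closed invariant subset of a compact `G`-space full if it meets every fibre of `p`. Full
-- sets contain minimal ones, and images of full sets under `G`-maps are full; so a `G`-map into an
-- irreducible space is onto. The measures on `Y` concentrated on a single fibre form a compact
-- `G`-space `probSpace`, the étale property giving continuity of the action. `Y` is strongly
-- proximal exactly when every full subset of `probSpace` contains Dirac measures over all units
-- (`isStronglyProximal_iff`).
--
-- Existence: strong proximality passes to any space whose points are separated by `G`-maps to
-- strongly proximal spaces. On a minimal full set of fibrewise measures every push-forward to a
-- target is Dirac, so each measure is supported at one point. Hence a minimal full subset of the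
-- fibre product of all strongly proximal spaces is a boundary, and the coordinates map it to every
-- boundary. Only a set of spaces is needed: an irreducible space is the closure of the orbits of a
-- section, so its points inject into the filters on `Arr X`.
--
-- Uniqueness: for two `G`-maps from an irreducible space to a strongly proximal one, their average
-- is a `G`-map into measures. Its image contains Dirac measures over all units; these being
-- extreme, the two maps agree on a full set, hence everywhere. So boundaries that map to each other
-- are isomorphic.

universe w''

set_option linter.unusedSectionVars false

namespace FurstenbergBoundary

/-! ### Regular probability measures with the weak* topology. -/

namespace RegularProb

open Filter Topology

variable {Y : Type w} [TopologicalSpace Y] [MeasurableSpace Y] [BorelSpace Y]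
  [CompactSpace Y] [T2Space Y]

theorem toMeasure_injective : Function.Injective (toMeasure : RegularProb Y → Measure Y) :=
  fun _ _ h => Subtype.ext (Subtype.ext h)

theorem integrable (μ : RegularProb Y) (f : C(Y, ℝ)) : Integrable f μ.toMeasure :=
  f.continuous.integrable_of_hasCompactSupport (HasCompactSupport.of_compactSpace f)

/-- Regular probability measures are determined by the integrals of continuous functions. -/
theorem ext_of_integral {μ ν : RegularProb Y}
    (h : ∀ f : C(Y, ℝ), ∫ y, f y ∂μ.toMeasure = ∫ y, f y ∂ν.toMeasure) : μ = ν :=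
  toMeasure_injective (Measure.ext_of_integral_eq_on_compactlySupported fun f => h f)

theorem isInducing_val : IsInducing fun μ : RegularProb Y => (μ.1 : ProbabilityMeasure Y) :=
  ⟨rfl⟩

theorem tendsto_iff {γ : Type*} {F : Filter γ} {μs : γ → RegularProb Y} {μ : RegularProb Y} :
    Tendsto μs F (𝓝 μ) ↔ ∀ f : C(Y, ℝ),
      Tendsto (fun i => ∫ y, f y ∂(μs i).toMeasure) F (𝓝 (∫ y, f y ∂μ.toMeasure)) := by
  rw [isInducing_val.tendsto_nhds_iff, ProbabilityMeasure.tendsto_iff_forall_integral_tendsto]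
  exact (ContinuousMap.equivBoundedOfCompact ..).symm.forall_congr_left

theorem continuous_integral (f : C(Y, ℝ)) :
    Continuous fun μ : RegularProb Y => ∫ y, f y ∂μ.toMeasure :=
  continuous_iff_continuousAt.2 fun _ => tendsto_iff.1 tendsto_id f

theorem continuous_of_integral {T : Type*} [TopologicalSpace T] {μs : T → RegularProb Y}
    (h : ∀ f : C(Y, ℝ), Continuous fun t => ∫ y, f y ∂(μs t).toMeasure) : Continuous μs :=
  continuous_iff_continuousAt.2 fun _ => tendsto_iff.2 fun f => (h f).continuousAt

/-- Every Borel probability measure has a regular companion with the same integrals. -/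
theorem exists_integral_eq (μ : Measure Y) [IsProbabilityMeasure μ] :
    ∃ ν : RegularProb Y, ∀ f : C(Y, ℝ), ∫ y, f y ∂ν.toMeasure = ∫ y, f y ∂μ := by
  obtain ⟨ν, hr, _, h⟩ := Measure.exists_regular_eq_of_compactSpace μ
  have h1 := h (BoundedContinuousFunction.const Y 1)
  simp only [BoundedContinuousFunction.const_apply, integral_const, smul_eq_mul, mul_one,
    probReal_univ] at h1
  have hν : IsProbabilityMeasure ν := ⟨by
    rw [← ENNReal.toReal_eq_one_iff]; exact h1.symm⟩
  exact ⟨⟨⟨ν, hν⟩, hr⟩, fun f => (h (BoundedContinuousFunction.mkOfCompact f)).symm⟩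

instance : T2Space (RegularProb Y) :=
  T2Space.of_injective_continuous (f := fun (μ : RegularProb Y) (f : C(Y, ℝ)) =>
    ∫ y, f y ∂μ.toMeasure) (fun _ _ h => ext_of_integral fun f => congrFun h f)
    (continuous_pi continuous_integral)

/-- A limit of an ultrafilter among all Borel probability measures may fail to be regular. Its
regular companion has the same integrals, hence is a limit too. -/
instance : CompactSpace (RegularProb Y) := by
  refine ⟨isCompact_iff_ultrafilter_le_nhds.2 fun F _ => ?_⟩
  obtain ⟨μ, -, hμ⟩ := isCompact_iff_ultrafilter_le_nhds.1
    (isCompact_univ (X := ProbabilityMeasure Y)) (F.map Subtype.val) (by simp)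
  obtain ⟨ν, hν⟩ := exists_integral_eq (μ : Measure Y)
  refine ⟨ν, mem_univ _, ?_⟩
  have key : Tendsto id (F : Filter (RegularProb Y)) (𝓝 ν) := by
    refine tendsto_iff.2 fun f => ?_
    rw [hν]
    have h2 : Tendsto Subtype.val (F : Filter (RegularProb Y)) (𝓝 μ) := hμ
    exact ProbabilityMeasure.tendsto_iff_forall_integral_tendsto.1 h2
      (BoundedContinuousFunction.mkOfCompact f)
  exact key

section Dirac

theorem toMeasure_dirac (y : Y) : (dirac y).toMeasure = Measure.dirac y := rfl

theorem integral_dirac (y : Y) (f : C(Y, ℝ)) : ∫ z, f z ∂(dirac y).toMeasure = f y := by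
  rw [toMeasure_dirac, MeasureTheory.integral_dirac]

theorem continuous_dirac : Continuous (dirac : Y → RegularProb Y) :=
  continuous_of_integral fun f => by simpa only [integral_dirac] using f.continuous

theorem dirac_injective : Function.Injective (dirac : Y → RegularProb Y) := fun _ _ h =>
  injective_diracProba (congrArg Subtype.val h)

theorem isClosedEmbedding_dirac : IsClosedEmbedding (dirac : Y → RegularProb Y) :=
  continuous_dirac.isClosedEmbedding dirac_injective

/-- A regular probability measure whose support is at most a point is a Dirac measure. -/
theorem exists_eq_dirac (μ : RegularProb Y)
    (h : ∀ y z, (∀ U ∈ 𝓝 y, μ.toMeasure U ≠ 0) → (∀ U ∈ 𝓝 z, μ.toMeasure U ≠ 0) → y = z) :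
    ∃ y, (∀ U ∈ 𝓝 y, μ.toMeasure U ≠ 0) ∧ μ = dirac y := by
  have h0 : ∀ K : Set Y, IsCompact K → (∀ y ∈ K, ∃ U ∈ 𝓝 y, μ.toMeasure U = 0) →
      μ.toMeasure K = 0 := fun K hK hn => hK.measure_zero_of_nhdsWithin fun y hy => by
    obtain ⟨U, hU, h⟩ := hn y hy
    exact ⟨U, mem_nhdsWithin_of_mem_nhds hU, h⟩
  obtain ⟨y, hy⟩ : ∃ y, ∀ U ∈ 𝓝 y, μ.toMeasure U ≠ 0 := by
    by_contra! hn
    have := h0 univ isCompact_univ fun y _ => hn y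
    simp at this
  refine ⟨y, hy, toMeasure_injective ?_⟩
  -- Otherwise inner regularity gives a compact set of positive measure avoiding `y`; it would
  -- contain a support point, which has to be `y`.
  have hc : μ.toMeasure {y}ᶜ = 0 := by
    by_contra hne
    obtain ⟨K, hKs, hK, hpos⟩ := isOpen_compl_singleton.exists_lt_isCompact
      (μ := μ.toMeasure) (pos_iff_ne_zero.2 hne)
    refine hpos.ne' (h0 K hK fun z hz => ?_)
    by_contra! hn
    exact hKs hz (h z y hn hy)
  have hae : ∀ᵐ z ∂μ.toMeasure, id z = y := by
    rw [ae_iff]; exact hc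
  calc μ.toMeasure = μ.toMeasure.map id := Measure.map_id.symm
    _ = μ.toMeasure.map fun _ => y := Measure.map_congr hae
    _ = (dirac y).toMeasure := by rw [Measure.map_const]; simp [toMeasure_dirac]

end Dirac

section Map

variable {Z : Type w'} [TopologicalSpace Z] [MeasurableSpace Z] [BorelSpace Z]
  [CompactSpace Z] [T2Space Z]

/-- Push-forward of regular probability measures along a continuous map. -/
noncomputable def map (f : Y → Z) (hf : Continuous f) (μ : RegularProb Y) : RegularProb Z :=
  ⟨⟨μ.toMeasure.map f, Measure.isProbabilityMeasure_map hf.aemeasurable⟩,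
    regular_map_of_continuous _ hf⟩

theorem integral_map {f : Y → Z} (hf : Continuous f) (μ : RegularProb Y) (k : C(Z, ℝ)) :
    ∫ z, k z ∂(map f hf μ).toMeasure = ∫ y, k (f y) ∂μ.toMeasure :=
  MeasureTheory.integral_map hf.aemeasurable k.continuous.aestronglyMeasurable

theorem continuous_map {f : Y → Z} (hf : Continuous f) : Continuous (map f hf) :=
  continuous_of_integral fun k => by
    simp only [integral_map]
    exact continuous_integral (k.comp ⟨f, hf⟩)

theorem map_dirac {f : Y → Z} (hf : Continuous f) (y : Y) : map f hf (dirac y) = dirac (f y) :=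
  ext_of_integral fun k => by
    rw [integral_map, integral_dirac]; exact integral_dirac y (k.comp ⟨f, hf⟩)

end Map

end RegularProb

/-! ### The compact `G`-space of fibrewise measures. -/

namespace CompactGSpace

open Filter Topology RegularProb

theorem act_congr {X : Type u} [TopologicalSpace X] [Groupoid.{v} X] [TopologicalSpace (Arr X)]
    (Y : CompactGSpace.{u, v, w} X) {g g' : Arr X} {y y' : Y} (hg : g = g')
    (hy : y = y') (h : g.src = Y.p y) (h' : g'.src = Y.p y') : Y.act g y h = Y.act g' y' h' := by
  subst hg; subst hy; rfl

variable {X : Type u} [TopologicalSpace X] [CompactSpace X] [T2Space X] [MeasurableSpace X]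
  [BorelSpace X] [Groupoid.{v} X] [TopologicalSpace (Arr X)]

section LiesOver

variable (Y : CompactGSpace.{u, v, w} X)

theorem liesOver_iff {μ : RegularProb Y} {x : X} :
    Y.LiesOver μ x ↔ RegularProb.map Y.p Y.continuous_p μ = dirac x :=
  ⟨fun h => toMeasure_injective h, fun h => congrArg toMeasure h⟩

theorem liesOver_dirac (y : Y) : Y.LiesOver (dirac y) (Y.p y) :=
  Y.liesOver_iff.2 (map_dirac Y.continuous_p y)

variable {Y}

theorem LiesOver.unique {μ : RegularProb Y} {x x' : X} (h : Y.LiesOver μ x)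
    (h' : Y.LiesOver μ x') : x = x' :=
  dirac_injective ((Y.liesOver_iff.1 h).symm.trans (Y.liesOver_iff.1 h'))

theorem LiesOver.ae_eq {μ : RegularProb Y} {x : X} (h : Y.LiesOver μ x) :
    ∀ᵐ y ∂μ.toMeasure, Y.p y = x := by
  rw [ae_iff]
  have : (μ.toMeasure.map Y.p) {x}ᶜ = 0 := by
    rw [h]; simp
  rwa [Measure.map_apply Y.continuous_p.measurable (measurableSet_singleton _).compl] at this

/-- Since `μ` lives on the fibre over `g.src`, only the values of `F` there matter. Integrating an
extension to all of `Y` keeps weak* continuity available. -/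
theorem integral_translate {μ : RegularProb Y} {g : Arr X} (h : Y.LiesOver μ g.src)
    (f F : C(Y, ℝ)) (hF : ∀ y (hy : g.src = Y.p y), F y = f (Y.act g y hy)) :
    ∫ y, f y ∂(Y.translate g μ h).toMeasure = ∫ y, F y ∂μ.toMeasure := by
  have he := (Y.isClosedEmbedding_fibre g).measurableEmbedding
  calc ∫ y, f y ∂(Y.translate g μ h).toMeasure
      = ∫ y : Y.SrcFibre g, f (Y.actFibre g y) ∂(μ.toMeasure.comap Subtype.val) :=
        MeasureTheory.integral_map (Y.continuous_actFibre g).aemeasurable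
          f.continuous.aestronglyMeasurable
    _ = ∫ y : Y.SrcFibre g, F y.1 ∂(μ.toMeasure.comap Subtype.val) :=
        integral_congr_ae (Eventually.of_forall fun y => (hF y.1 y.2).symm)
    _ = ∫ y, F y ∂((μ.toMeasure.comap (Subtype.val : Y.SrcFibre g → Y)).map Subtype.val) :=
        (he.integral_map _).symm
    _ = ∫ y, F y ∂μ.toMeasure := by
        rw [he.map_comap, Measure.restrict_eq_self_of_ae_mem]
        filter_upwards [h.ae_eq] with y hy
        exact ⟨⟨y, hy.symm⟩, rfl⟩

end LiesOver

variable [IsEtaleGroupoid X]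

/-- Near a given arrow, translation by arrows of a function is given by a single continuous
function on the whole space. -/
theorem exists_eventually_eq_act (Y : CompactGSpace.{u, v, w} X) (g₀ : Arr X) (f : C(Y, ℝ)) :
    ∃ F : C(Y, ℝ), ∀ᶠ g in 𝓝 g₀, ∀ y (hy : g.src = Y.p y), F y = f (Y.act g y hy) := by
  -- Arrows near `g₀` are recovered from their source by the local section `e.symm`, so `f (g y)`
  -- becomes a function of `y` alone over a closed neighbourhood `K` of the source; Tietze extends
  -- it.
  obtain ⟨e, hg₀, he⟩ := IsEtaleGroupoid.isLocalHomeomorph_src (X := X) g₀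
  have hsrc : ∀ g, e g = g.src := fun g => congrFun he.symm g
  obtain ⟨K, hK, hKc, hKt⟩ := exists_mem_nhds_isClosed_subset
    (e.open_target.mem_nhds (e.map_source hg₀))
  have hy : ∀ y : Y.p ⁻¹' K, (e.symm (Y.p y)).src = Y.p y := fun y => by
    rw [← hsrc, e.right_inv (hKt y.2)]
  have hcont : Continuous fun y : Y.p ⁻¹' K => f (Y.act (e.symm (Y.p y)) y (hy y)) := by
    refine f.continuous.comp (Y.continuous_act.comp (f := fun y : Y.p ⁻¹' K =>
      (⟨(e.symm (Y.p y), y), hy y⟩ : {q : Arr X × Y // q.1.src = Y.p q.2})) ?_)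
    refine Continuous.subtype_mk (Continuous.prodMk ?_ continuous_subtype_val) _
    exact e.continuousOn_symm.comp_continuous
      (Y.continuous_p.comp continuous_subtype_val) fun y => hKt y.2
  obtain ⟨F, hF⟩ := ContinuousMap.exists_restrict_eq (hKc.preimage Y.continuous_p) ⟨_, hcont⟩
  refine ⟨F, ?_⟩
  filter_upwards [e.open_source.mem_nhds hg₀, e.continuousAt hg₀ hK] with g hgs hgK y hgy
  have hyK : Y.p y ∈ K := by rw [← hgy, ← hsrc]; exact hgK
  have h1 : F y = f (Y.act (e.symm (Y.p y)) y (hy ⟨y, hyK⟩)) :=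
    congrArg (fun k : C(Y.p ⁻¹' K, ℝ) => k ⟨y, hyK⟩) hF
  rw [h1]
  refine congrArg f (Y.act_congr ?_ rfl _ _)
  rw [← hgy, ← hsrc, e.left_inv hgs]

theorem exists_eq_act (Y : CompactGSpace.{u, v, w} X) (g : Arr X) (f : C(Y, ℝ)) :
    ∃ F : C(Y, ℝ), ∀ y (hy : g.src = Y.p y), F y = f (Y.act g y hy) :=
  (Y.exists_eventually_eq_act g f).imp fun _ h => h.self_of_nhds

theorem liesOver_translate (Y : CompactGSpace.{u, v, w} X) {g : Arr X} {μ : RegularProb Y}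
    (h : Y.LiesOver μ g.src) : Y.LiesOver (Y.translate g μ h) g.tgt := by
  refine Y.liesOver_iff.2 (ext_of_integral fun k => ?_)
  rw [RegularProb.integral_map, RegularProb.integral_dirac]
  refine (integral_translate h (k.comp ⟨Y.p, Y.continuous_p⟩)
    (ContinuousMap.const _ (k g.tgt)) fun y hy => ?_).trans (by simp)
  simp [Y.p_act]

/-- The compact `G`-space of regular probability measures on `Y` that are concentrated on a fibre
of `Y` over the unit space. -/
noncomputable def probSpace (Y : CompactGSpace.{u, v, w} X) : CompactGSpace.{u, v, w} X where
  carrier := {μ : RegularProb Y // ∃ x, Y.LiesOver μ x}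
  compact := by
    refine isCompact_iff_compactSpace.1 (IsClosed.isCompact ?_)
    have : {μ : RegularProb Y | ∃ x, Y.LiesOver μ x} =
        RegularProb.map Y.p Y.continuous_p ⁻¹' range dirac :=
      Set.ext fun μ => exists_congr fun x => Y.liesOver_iff.trans eq_comm
    change IsClosed {μ : RegularProb Y | ∃ x, Y.LiesOver μ x}
    rw [this]
    exact isClosedEmbedding_dirac.isClosed_range.preimage
      (RegularProb.continuous_map Y.continuous_p)
  p μ := μ.2.choose
  continuous_p := by
    -- After embedding `X` by Dirac measures, the projection becomes push-forward along `Y.p`.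
    refine (isClosedEmbedding_dirac (Y := X)).isInducing.continuous_iff.2 ?_
    refine ((RegularProb.continuous_map Y.continuous_p).comp continuous_subtype_val).congr ?_
    exact fun μ => Y.liesOver_iff.1 μ.2.choose_spec
  surjective_p x := by
    obtain ⟨y, rfl⟩ := Y.surjective_p x
    exact ⟨⟨dirac y, _, Y.liesOver_dirac y⟩,
      LiesOver.unique (Exists.choose_spec _) (Y.liesOver_dirac y)⟩
  act g μ h := ⟨Y.translate g μ.1 (h ▸ μ.2.choose_spec), _,
    Y.liesOver_translate (h ▸ μ.2.choose_spec : Y.LiesOver μ.1 g.src)⟩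
  p_act g μ h := LiesOver.unique (Exists.choose_spec _)
    (Y.liesOver_translate (h ▸ μ.2.choose_spec : Y.LiesOver μ.1 g.src))
  unit_act μ := Subtype.ext <| ext_of_integral fun f =>
    integral_translate (g := Arr.unit _) μ.2.choose_spec f f fun y hy =>
      congrArg f <| (Y.unit_act y).symm.trans <| Y.act_congr (congrArg Arr.unit hy.symm) rfl rfl hy
  mul_act g h e μ hμ := Subtype.ext <| ext_of_integral fun f => by
    obtain ⟨F, hF⟩ := Y.exists_eq_act g f
    obtain ⟨F', hF'⟩ := Y.exists_eq_act h F
    have hF'' : ∀ y (hy : (Arr.mul g h e).src = Y.p y), F' y = f (Y.act (Arr.mul g h e) y hy) :=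
      fun y hy => (hF' y hy).trans ((hF _ (e.trans (Y.p_act _ _ _).symm)).trans
        (congrArg f (Y.mul_act g h e y hy).symm))
    have hμ' : Y.LiesOver μ.1 h.src := hμ ▸ μ.2.choose_spec
    have hμ'' : Y.LiesOver (Y.translate h μ.1 hμ') g.src := e ▸ Y.liesOver_translate hμ'
    exact (integral_translate (g := Arr.mul g h e) hμ' f F' hF'').trans
      ((integral_translate hμ'' f F hF).trans (integral_translate hμ' F F' hF')).symm
  continuous_act := by
    refine Continuous.subtype_mk (continuous_iff_continuousAt.2 fun q => ?_) _
    refine tendsto_iff.2 fun f => ?_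
    -- A single `F` serves all arrows near `q.1.1`, so only the measure varies in the integral.
    obtain ⟨F, hF⟩ := Y.exists_eventually_eq_act q.1.1 f
    have hF' := (continuous_fst.comp continuous_subtype_val).continuousAt (x := q) hF
    have hc : Continuous fun q : {q : Arr X × {μ : RegularProb Y // ∃ x, Y.LiesOver μ x} //
        q.1.src = q.2.2.choose} => ∫ y, F y ∂q.1.2.1.toMeasure :=
      (RegularProb.continuous_integral F).comp (by fun_prop)
    have hq := hF.self_of_nhds
    have hl : ∀ r : {q : Arr X × {μ : RegularProb Y // ∃ x, Y.LiesOver μ x} //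
        q.1.src = q.2.2.choose}, Y.LiesOver r.1.2.1 r.1.1.src := fun r =>
      r.2 ▸ r.1.2.2.choose_spec
    refine Tendsto.congr' ?_ ((hc.tendsto q).trans_eq
      (congrArg 𝓝 (integral_translate (hl q) f F hq).symm))
    filter_upwards [hF'] with r hr
    exact (integral_translate (hl r) f F hr).symm

end CompactGSpace

/-! ### Full sets, minimality and `G`-maps. -/

namespace CompactGSpace

open Filter Topology

section Invariant

variable {X : Type u} [TopologicalSpace X] [Groupoid.{v} X] [TopologicalSpace (Arr X)]

/-- A local section of the source map through `g` extends `y ↦ g y` to a continuous map on an open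
neighbourhood of `y`, which sends points of `A` into `A`. -/
theorem IsInvariant.closure [IsEtaleGroupoid X] {Y : CompactGSpace.{u, v, w} X} {A : Set Y}
    (hA : Y.IsInvariant A) : Y.IsInvariant (closure A) := by
  intro g y h hyA
  obtain ⟨e, hg, he⟩ := IsEtaleGroupoid.isLocalHomeomorph_src (X := X) g
  have hsrc : ∀ g, e g = g.src := fun g => congrFun he.symm g
  let S : Set Y := Y.p ⁻¹' e.target
  have hS : IsOpen S := e.open_target.preimage Y.continuous_p
  have hy : ∀ z : S, (e.symm (Y.p z)).src = Y.p z := fun z => by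
    rw [← hsrc, e.right_inv z.2]
  have hcont : Continuous fun z : S => Y.act (e.symm (Y.p z)) z (hy z) := by
    refine Y.continuous_act.comp (f := fun z : S =>
      (⟨(e.symm (Y.p z), z), hy z⟩ : {q : Arr X × Y // q.1.src = Y.p q.2})) ?_
    refine Continuous.subtype_mk (Continuous.prodMk ?_ continuous_subtype_val) _
    exact e.continuousOn_symm.comp_continuous
      (Y.continuous_p.comp continuous_subtype_val) fun z => z.2
  have hyS : y ∈ S := by
    change Y.p y ∈ e.target
    rw [← h, ← hsrc]
    exact e.map_source hg
  have hmem : (⟨y, hyS⟩ : S) ∈ _root_.closure ((↑) ⁻¹' A : Set S) := by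
    rw [← hS.isOpenMap_subtype_val.preimage_closure_eq_closure_preimage continuous_subtype_val]
    exact hyA
  have hmaps : MapsTo (fun z : S => Y.act (e.symm (Y.p z)) z (hy z)) ((↑) ⁻¹' A) A :=
    fun z hz => hA _ _ _ hz
  have := map_mem_closure hcont hmem hmaps
  have heq : e.symm (Y.p y) = g := by rw [← h, ← hsrc, e.left_inv hg]
  simpa only [heq] using this

/-- The union of the orbits of the points of a set. -/
def saturation (Y : CompactGSpace.{u, v, w} X) (S : Set Y) : Set Y :=
  {z | ∃ (g : Arr X) (y : Y) (h : g.src = Y.p y), y ∈ S ∧ Y.act g y h = z}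

theorem isInvariant_saturation (Y : CompactGSpace.{u, v, w} X) (S : Set Y) :
    Y.IsInvariant (Y.saturation S) := by
  rintro g _ h ⟨k, y, hk, hy, rfl⟩
  exact ⟨Arr.mul g k (h.trans (Y.p_act _ _ _)), y, hk, hy, Y.mul_act _ _ _ _ _⟩

theorem subset_saturation (Y : CompactGSpace.{u, v, w} X) (S : Set Y) : S ⊆ Y.saturation S :=
  fun y hy => ⟨Arr.unit (Y.p y), y, rfl, hy, Y.unit_act y⟩

/-- A closed invariant set that projects onto the unit space. -/
structure IsFull (Y : CompactGSpace.{u, v, w} X) (A : Set Y) : Prop where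
  isClosed : IsClosed A
  isInvariant : Y.IsInvariant A
  image_p : Y.p '' A = univ

variable {Y : CompactGSpace.{u, v, w} X}

theorem IsFull.exists_mem {A : Set Y} (hA : Y.IsFull A) (x : X) : ∃ y ∈ A, Y.p y = x :=
  (hA.image_p.symm ▸ mem_univ x : x ∈ Y.p '' A)

theorem isFull_univ (Y : CompactGSpace.{u, v, w} X) : Y.IsFull univ :=
  ⟨isClosed_univ, fun _ _ _ _ => mem_univ _, by rw [image_univ, Y.surjective_p.range_eq]⟩

theorem isFull_closure_saturation [IsEtaleGroupoid X] {S : Set Y}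
    (hS : ∀ x, ∃ y ∈ S, Y.p y = x) : Y.IsFull (closure (Y.saturation S)) where
  isClosed := isClosed_closure
  isInvariant := (Y.isInvariant_saturation S).closure
  image_p := eq_univ_of_forall fun x => by
    obtain ⟨y, hy, rfl⟩ := hS x
    exact ⟨y, subset_closure (Y.subset_saturation S hy), rfl⟩

/-- Every closed invariant set over the whole unit space contains a minimal one. -/
theorem IsFull.exists_minimal [T1Space X] {A : Set Y} (hA : Y.IsFull A) :
    ∃ C ⊆ A, Minimal Y.IsFull C := by
  refine zorn_superset_nonempty {C : Set Y | Y.IsFull C} (fun c hc hchain hne => ?_) A hA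
  refine ⟨⋂₀ c, ⟨isClosed_sInter fun C hC => (hc hC).isClosed,
    fun g y h hy C hC => (hc hC).isInvariant g y h (hy C hC), ?_⟩,
    fun C hC => sInter_subset_of_mem hC⟩
  refine eq_univ_of_forall fun x => ?_
  have : Nonempty c := hne.to_subtype
  have hcl : ∀ C : c, IsClosed (C.1 ∩ Y.p ⁻¹' {x}) := fun C =>
    (hc C.2).isClosed.inter (isClosed_singleton.preimage Y.continuous_p)
  -- Compactness is used inside the fibre over `x`, so that the intersection of the chain still
  -- meets every fibre.
  obtain ⟨y, hy⟩ := IsCompact.nonempty_iInter_of_directed_nonempty_isCompact_isClosed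
    (fun C : c => C.1 ∩ Y.p ⁻¹' {x})
    (by
      intro C D
      rcases hchain.total C.2 D.2 with h | h
      · exact ⟨C, Subset.rfl, inter_subset_inter_left _ h⟩
      · exact ⟨D, inter_subset_inter_left _ h, Subset.rfl⟩)
    (fun C => by
      obtain ⟨y, hy, hx⟩ := (hc C.2).exists_mem x
      exact ⟨y, hy, hx⟩)
    (fun C => (hcl C).isCompact) hcl
  rw [mem_iInter] at hy
  exact ⟨y, fun C hC => (hy ⟨C, hC⟩).1, (hy (Classical.arbitrary c)).2⟩

/-- A closed invariant set over the whole unit space as a compact `G`-space. -/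
def IsFull.toGSpace {A : Set Y} (hA : Y.IsFull A) : CompactGSpace.{u, v, w} X where
  carrier := A
  compact := isCompact_iff_compactSpace.1 hA.isClosed.isCompact
  p y := Y.p y
  continuous_p := Y.continuous_p.comp continuous_subtype_val
  surjective_p x := by
    obtain ⟨y, hy, hx⟩ := hA.exists_mem x
    exact ⟨⟨y, hy⟩, hx⟩
  act g y h := ⟨Y.act g y h, hA.isInvariant g y h y.2⟩
  p_act g y h := Y.p_act g y h
  unit_act y := Subtype.ext (Y.unit_act y)
  mul_act g h e y hy := Subtype.ext (Y.mul_act g h e y hy)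
  continuous_act := by
    refine Continuous.subtype_mk (Y.continuous_act.comp (f := fun q : {q : Arr X × A //
      q.1.src = Y.p q.2} => (⟨(q.1.1, q.1.2), q.2⟩ : {q : Arr X × Y // q.1.src = Y.p q.2})) ?_) _
    fun_prop

namespace GMap

variable {Z : CompactGSpace.{u, v, w'} X}

@[ext]
theorem ext {φ ψ : GMap Y Z} (h : ∀ y, φ.toFun y = ψ.toFun y) : φ = ψ := by
  cases φ; cases ψ
  congr
  exact funext h

/-- The identity `G`-map. -/
def id (Y : CompactGSpace.{u, v, w} X) : GMap Y Y :=
  ⟨fun y => y, continuous_id, fun _ => rfl, fun _ _ _ => rfl⟩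

/-- Composition of `G`-maps. -/
def comp {W : CompactGSpace.{u, v, w''} X} (ψ : GMap Z W) (φ : GMap Y Z) : GMap Y W where
  toFun y := ψ.toFun (φ.toFun y)
  continuous_toFun := ψ.continuous_toFun.comp φ.continuous_toFun
  p_toFun y := (ψ.p_toFun _).trans (φ.p_toFun y)
  toFun_act g y h := by rw [φ.toFun_act, ψ.toFun_act]

theorem image_isFull (φ : GMap Y Z) {A : Set Y} (hA : Y.IsFull A) : Z.IsFull (φ.toFun '' A) where
  isClosed := (hA.isClosed.isCompact.image φ.continuous_toFun).isClosed
  isInvariant := by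
    rintro g _ h ⟨y, hy, rfl⟩
    have h' := h.trans (φ.p_toFun y)
    exact ⟨Y.act g y h', hA.isInvariant g y h' hy, φ.toFun_act g y h'⟩
  image_p := by
    rw [image_image, ← hA.image_p]
    exact image_congr fun y _ => φ.p_toFun y

theorem isInvariant_preimage (φ : GMap Y Z) {A : Set Z} (hA : Z.IsInvariant A) :
    Y.IsInvariant (φ.toFun ⁻¹' A) := fun g y h hy => by
  rw [mem_preimage, φ.toFun_act]
  exact hA _ _ _ hy

theorem surjective (φ : GMap Y Z) (hZ : Z.IsIrreducible) : Function.Surjective φ.toFun := by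
  have h := φ.image_isFull Y.isFull_univ
  have := hZ _ h.isClosed h.isInvariant h.image_p
  rwa [image_univ, range_eq_univ] at this

end GMap

/-- The inclusion of a closed invariant set. -/
def IsFull.incl {A : Set Y} (hA : Y.IsFull A) : GMap hA.toGSpace Y :=
  ⟨Subtype.val, continuous_subtype_val, fun _ => rfl, fun _ _ _ => rfl⟩

theorem isIrreducible_toGSpace {A : Set Y} (hA : Minimal Y.IsFull A) :
    hA.prop.toGSpace.IsIrreducible := by
  intro C hC hinv himg
  have h := hA.prop.incl.image_isFull ⟨hC, hinv, himg⟩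
  have hle : hA.prop.incl.toFun '' C ⊆ A := by
    rintro _ ⟨y, -, rfl⟩
    exact y.2
  refine eq_univ_of_forall fun y => ?_
  obtain ⟨z, hz, hzy⟩ := hA.le_of_le h hle y.2
  rwa [← Subtype.ext hzy]

end Invariant

/-! ### Strong proximality through fibrewise measures, and rigidity of `G`-maps. -/

open RegularProb

variable {X : Type u} [TopologicalSpace X] [CompactSpace X] [T2Space X] [MeasurableSpace X]
  [BorelSpace X] [Groupoid.{v} X] [TopologicalSpace (Arr X)] [IsEtaleGroupoid X]

theorem p_probSpace {Y : CompactGSpace.{u, v, w} X} {μ : Y.probSpace} {x : X}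
    (h : Y.LiesOver μ.1 x) : Y.probSpace.p μ = x :=
  LiesOver.unique (Exists.choose_spec μ.2) h

theorem liesOver_p (Y : CompactGSpace.{u, v, w} X) (μ : Y.probSpace) :
    Y.LiesOver μ.1 (Y.probSpace.p μ) :=
  Exists.choose_spec μ.2

/-- The embedding of `Y` by Dirac measures. -/
noncomputable def diracMap (Y : CompactGSpace.{u, v, w} X) : GMap Y Y.probSpace where
  toFun y := ⟨dirac y, _, Y.liesOver_dirac y⟩
  continuous_toFun := continuous_dirac.subtype_mk _
  p_toFun y := p_probSpace (Y.liesOver_dirac y)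
  toFun_act g y h := Subtype.ext <| ext_of_integral fun f => by
    obtain ⟨F, hF⟩ := Y.exists_eq_act g f
    have hl : Y.LiesOver (dirac y) g.src := by rw [h]; exact Y.liesOver_dirac y
    refine Eq.trans ?_ (integral_translate hl f F hF).symm
    exact (RegularProb.integral_dirac _ f).trans
      ((hF y h).symm.trans (RegularProb.integral_dirac y F).symm)

/-- Push-forward of measures along a `G`-map. -/
noncomputable def GMap.probMap {Y : CompactGSpace.{u, v, w} X} {Z : CompactGSpace.{u, v, w'} X}
    (φ : GMap Y Z) : GMap Y.probSpace Z.probSpace :=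
  have hl : ∀ (μ : RegularProb Y) (x : X), Y.LiesOver μ x →
      Z.LiesOver (RegularProb.map φ.toFun φ.continuous_toFun μ) x := fun μ x h => by
    refine Z.liesOver_iff.2 (ext_of_integral fun k => ?_)
    rw [← Y.liesOver_iff.1 h, RegularProb.integral_map, RegularProb.integral_map]
    refine (RegularProb.integral_map φ.continuous_toFun μ (k.comp ⟨_, Z.continuous_p⟩)).trans ?_
    simp [φ.p_toFun]
  { toFun μ := ⟨RegularProb.map φ.toFun φ.continuous_toFun μ.1, _, hl _ _ (Y.liesOver_p μ)⟩
    continuous_toFun :=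
      ((RegularProb.continuous_map φ.continuous_toFun).comp continuous_subtype_val).subtype_mk _
    p_toFun μ := p_probSpace (hl _ _ (Y.liesOver_p μ))
    toFun_act g μ h := Subtype.ext <| ext_of_integral fun f => by
      obtain ⟨F, hF⟩ := Z.exists_eq_act g f
      have hμ : Y.LiesOver μ.1 g.src := h ▸ Y.liesOver_p μ
      refine (RegularProb.integral_map φ.continuous_toFun _ f).trans ?_
      refine Eq.trans ?_ (integral_translate (hl _ _ hμ) f F hF).symm
      rw [RegularProb.integral_map]
      refine integral_translate hμ (f.comp ⟨_, φ.continuous_toFun⟩)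
        (F.comp ⟨_, φ.continuous_toFun⟩) fun y hy => ?_
      exact (hF _ (hy.trans (φ.p_toFun y).symm)).trans (congrArg f (φ.toFun_act g y hy).symm) }

/-- A full set supplies a family of measures whose orbit stays inside it; conversely the closed
orbit of a family is full. This form allows minimality arguments. -/
theorem isStronglyProximal_iff {Y : CompactGSpace.{u, v, w} X} :
    Y.IsStronglyProximal ↔ ∀ A, Y.probSpace.IsFull A →
      ∀ x, ∃ y, Y.p y = x ∧ Y.diracMap.toFun y ∈ A := by
  constructor
  · intro h A hA x
    choose μ hμA hμ using hA.exists_mem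
    obtain ⟨y, hy, rfl⟩ := h (fun x => (μ x).1) (fun x => by
      have := Y.liesOver_p (μ x)
      rwa [hμ] at this) (mem_univ x)
    refine ⟨y, rfl, ?_⟩
    have hcl : IsClosed (Subtype.val '' A : Set (RegularProb Y)) :=
      (hA.isClosed.isCompact.image continuous_subtype_val).isClosed
    have hsub : Y.orbit (range fun x => (μ x).1) ⊆ Subtype.val '' A := by
      rintro _ ⟨g, _, hg, ⟨x, rfl⟩, rfl⟩
      exact ⟨_, hA.isInvariant g (μ x) (LiesOver.unique hg (Y.liesOver_p _)) (hμA x), rfl⟩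
    obtain ⟨ν, hν, hνy⟩ := closure_minimal hsub hcl hy
    rwa [show Y.diracMap.toFun y = ν from Subtype.ext hνy.symm]
  · intro h μ hμ x _
    have hfull := isFull_closure_saturation (Y := Y.probSpace)
      (S := range fun x => ⟨μ x, x, hμ x⟩) fun x => ⟨_, ⟨x, rfl⟩, p_probSpace (hμ x)⟩
    obtain ⟨y, hyx, hy⟩ := h _ hfull x
    have hval : Continuous fun ν : Y.probSpace => (ν.1 : RegularProb Y) := continuous_subtype_val
    refine ⟨y, map_mem_closure (f := fun ν : Y.probSpace => (ν.1 : RegularProb Y))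
      (s := Y.probSpace.saturation _) hval hy ?_, hyx⟩
    rintro _ ⟨g, _, hg, ⟨x, rfl⟩, rfl⟩
    exact ⟨g, μ x, (hg.trans (p_probSpace (hμ x))) ▸ hμ x, ⟨x, rfl⟩, rfl⟩

/-- A compact `G`-space whose points are separated by `G`-maps to strongly proximal spaces is
strongly proximal. -/
theorem isStronglyProximal_of_separating {ι : Type*} {Z : CompactGSpace.{u, v, w} X}
    {Y : ι → CompactGSpace.{u, v, w'} X} (π : ∀ i, GMap Z (Y i))
    (hsep : ∀ a b, Z.p a = Z.p b → (∀ i, (π i).toFun a = (π i).toFun b) → a = b)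
    (hY : ∀ i, (Y i).IsStronglyProximal) : Z.IsStronglyProximal := by
  refine isStronglyProximal_iff.2 fun A hA x => ?_
  obtain ⟨C, hCA, hC⟩ := hA.exists_minimal
  have hdirac : ∀ i, ∀ ν ∈ C, ∃ y, (π i).probMap.toFun ν = (Y i).diracMap.toFun y := by
    intro i
    have hr := (Y i).diracMap.image_isFull (isFull_univ _)
    rw [image_univ] at hr
    -- Strong proximality of `Y i`, applied to the image of `C`, yields a measure in `C` with Dirac
    -- push-forward over each unit. Minimality then forces this for all of `C`, for every `i` at
    -- once.
    have hfull : Z.probSpace.IsFull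
        (C ∩ (π i).probMap.toFun ⁻¹' range (Y i).diracMap.toFun) := by
      refine ⟨hC.prop.isClosed.inter (hr.isClosed.preimage (π i).probMap.continuous_toFun),
        fun g y h hy => ⟨hC.prop.isInvariant g y h hy.1,
          (π i).probMap.isInvariant_preimage hr.isInvariant g y h hy.2⟩,
        eq_univ_of_forall fun x => ?_⟩
      obtain ⟨y, hyx, ν, hν, hνy⟩ :=
        isStronglyProximal_iff.1 (hY i) _ ((π i).probMap.image_isFull hC.prop) x
      refine ⟨ν, ⟨hν, y, hνy.symm⟩, ?_⟩
      rw [← (π i).probMap.p_toFun, hνy, (Y i).diracMap.p_toFun, hyx]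
    intro ν hν
    obtain ⟨y, hy⟩ := (hC.le_of_le hfull inter_subset_left hν).2
    exact ⟨y, hy.symm⟩
  obtain ⟨ν, hν, hνx⟩ := hC.prop.exists_mem x
  choose y hy using fun i => hdirac i ν hν
  have hp : ∀ a, (∀ U ∈ 𝓝 a, ν.1.toMeasure U ≠ 0) → Z.p a = x := by
    intro a ha
    by_contra hne
    refine ha _ (Z.continuous_p.continuousAt (isOpen_compl_singleton.mem_nhds hne)) ?_
    have := (Z.liesOver_p ν).ae_eq
    rwa [hνx] at this
  have hπ : ∀ a, (∀ U ∈ 𝓝 a, ν.1.toMeasure U ≠ 0) → ∀ i, (π i).toFun a = y i := by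
    intro a ha i
    by_contra hne
    refine ha _ ((π i).continuous_toFun.continuousAt (isOpen_compl_singleton.mem_nhds hne)) ?_
    have h1 : ν.1.toMeasure.map (π i).toFun = Measure.dirac (y i) :=
      congrArg (fun μ : (Y i).probSpace => μ.1.toMeasure) (hy i)
    rw [← Measure.map_apply (π i).continuous_toFun.measurable
      (measurableSet_singleton _).compl, h1]
    simp
  obtain ⟨z, hz, hνz⟩ := ν.1.exists_eq_dirac fun a b ha hb =>
    hsep a b ((hp a ha).trans (hp b hb).symm) fun i => (hπ a ha i).trans (hπ b hb i).symm
  refine ⟨z, hp z hz, hCA ?_⟩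
  rwa [show Z.diracMap.toFun z = ν from Subtype.ext hνz.symm]

section Midpoint

theorem exists_midpoint {Y : Type w} [TopologicalSpace Y] [MeasurableSpace Y] [BorelSpace Y]
    [CompactSpace Y] [T2Space Y] (a b : Y) :
    ∃ μ : RegularProb Y, ∀ f : C(Y, ℝ), ∫ y, f y ∂μ.toMeasure = (f a + f b) / 2 := by
  have hprob : IsProbabilityMeasure ((2⁻¹ : ENNReal) • (Measure.dirac a + Measure.dirac b)) :=
    ⟨by simp [ENNReal.inv_two_add_inv_two]⟩
  obtain ⟨μ, hμ⟩ := exists_integral_eq ((2⁻¹ : ENNReal) • (Measure.dirac a + Measure.dirac b))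
  refine ⟨μ, fun f => ?_⟩
  rw [hμ, integral_smul_measure, integral_add_measure
    (toMeasure_dirac a ▸ (dirac a).integrable f) (toMeasure_dirac b ▸ (dirac b).integrable f),
    MeasureTheory.integral_dirac, MeasureTheory.integral_dirac]
  simp
  ring

/-- The average of two `G`-maps, with values in the space of measures. -/
theorem exists_midpointMap {M : CompactGSpace.{u, v, w} X} {Y : CompactGSpace.{u, v, w'} X}
    (φ ψ : GMap M Y) : ∃ θ : GMap M Y.probSpace, ∀ m (f : C(Y, ℝ)),
      ∫ y, f y ∂(θ.toFun m).1.toMeasure = (f (φ.toFun m) + f (ψ.toFun m)) / 2 := by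
  choose μ hμ using fun m => exists_midpoint (φ.toFun m) (ψ.toFun m)
  have hl : ∀ m, Y.LiesOver (μ m) (M.p m) := fun m => by
    refine Y.liesOver_iff.2 (ext_of_integral fun k => ?_)
    rw [RegularProb.integral_map, RegularProb.integral_dirac]
    refine (hμ m (k.comp ⟨_, Y.continuous_p⟩)).trans ?_
    simp [φ.p_toFun, ψ.p_toFun]
  refine ⟨⟨fun m => ⟨μ m, _, hl m⟩, Continuous.subtype_mk (continuous_of_integral fun f => ?_) _,
    fun m => p_probSpace (hl m), fun g m h => Subtype.ext <| ext_of_integral fun f => ?_⟩, hμ⟩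
  · simp only [hμ]
    have := φ.continuous_toFun
    have := ψ.continuous_toFun
    fun_prop
  · obtain ⟨F, hF⟩ := Y.exists_eq_act g f
    have hlg : Y.LiesOver (μ m) g.src := by rw [h]; exact hl m
    refine Eq.trans ?_ (integral_translate hlg f F hF).symm
    rw [hμ, hμ, φ.toFun_act g m h, ψ.toFun_act g m h, hF, hF]

end Midpoint

/-- There is at most one `G`-map from an irreducible to a strongly proximal space. -/
theorem GMap.eq_of_isIrreducible {M : CompactGSpace.{u, v, w} X} {Y : CompactGSpace.{u, v, w'} X}
    (hM : M.IsIrreducible) (hY : Y.IsStronglyProximal) (φ ψ : GMap M Y) : φ = ψ := by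
  obtain ⟨θ, hθ⟩ := exists_midpointMap φ ψ
  -- Dirac measures are extreme: a Urysohn function equal to `0` at `a`, `1` at `b` and nonnegative
  -- at `c` would give `0 ≥ 1/2`.
  have hne : ∀ (a b c : Y), (∀ f : C(Y, ℝ), f a = (f b + f c) / 2) → b = a := by
    intro a b c h
    by_contra hne
    obtain ⟨f, h0, h1, hf⟩ := exists_continuous_zero_one_of_isClosed
      (isClosed_singleton (x := a)) (isClosed_singleton (x := b)) (by simpa using Ne.symm hne)
    have e0 : f a = 0 := h0 rfl
    have e1 : f b = 1 := h1 rfl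
    have := h f
    have := (hf c).1
    linarith
  have hE : {m | φ.toFun m = ψ.toFun m} = univ := by
    refine hM _ (isClosed_eq φ.continuous_toFun ψ.continuous_toFun) (fun g m h hm => ?_)
      (eq_univ_of_forall fun x => ?_)
    · change _ = _
      rw [φ.toFun_act g m h, ψ.toFun_act g m h]
      exact Y.act_congr rfl hm _ _
    · obtain ⟨y, hyx, m, -, hm⟩ :=
        isStronglyProximal_iff.1 hY _ (θ.image_isFull M.isFull_univ) x
      have hf : ∀ f : C(Y, ℝ), f y = (f (φ.toFun m) + f (ψ.toFun m)) / 2 := fun f => by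
        rw [← hθ m f, hm]
        exact (RegularProb.integral_dirac y f).symm
      have h1 := hne _ _ _ hf
      have h2 := hne y (ψ.toFun m) (φ.toFun m) fun f => (hf f).trans (by rw [add_comm])
      refine ⟨m, h1.trans h2.symm, ?_⟩
      rw [← φ.p_toFun, h1, hyx]
  exact GMap.ext fun m => (hE.symm ▸ mem_univ m : m ∈ {m | φ.toFun m = ψ.toFun m})

end CompactGSpace

/-! ### Transport of structure, size bound and fibre products. -/

open Filter Topology CompactGSpace

section

variable {X : Type u} [TopologicalSpace X] [Groupoid.{v} X] [TopologicalSpace (Arr X)]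

variable (X) in
/-- The structure of a compact `G`-space on a given type. -/
structure GSpaceStructure (C : Type w) where
  topology : TopologicalSpace C
  compact : CompactSpace C
  t2 : T2Space C
  p : C → X
  continuous_p : Continuous p
  surjective_p : Function.Surjective p
  act : (g : Arr X) → (y : C) → g.src = p y → C
  p_act : ∀ g y h, p (act g y h) = g.tgt
  unit_act : ∀ y, act (Arr.unit (p y)) y rfl = y
  mul_act : ∀ (g h : Arr X) (e : g.src = h.tgt) (y : C) (hy : h.src = p y),
    act (Arr.mul g h e) y hy = act g (act h y hy) (e.trans (p_act h y hy).symm)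
  continuous_act : Continuous fun q : {q : Arr X × C // q.1.src = p q.2} =>
    act q.1.1 q.1.2 q.2

namespace GSpaceStructure

/-- The compact `G`-space given by a `G`-space structure on a type. -/
def toGSpace {C : Type w} (S : GSpaceStructure.{u, v, w} X C) : CompactGSpace.{u, v, w} X :=
  { S with carrier := C }

variable {C : Type w} (Y : CompactGSpace.{u, v, w'} X) (e : C ≃ Y)

/-- Transport of the structure of a compact `G`-space along a bijection. -/
def ofEquiv : GSpaceStructure X C :=
  letI := TopologicalSpace.induced e inferInstance
  letI E : C ≃ₜ Y := e.toHomeomorphOfIsInducing ⟨rfl⟩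
  { topology := inferInstance
    compact := E.symm.compactSpace
    t2 := E.symm.t2Space
    p c := Y.p (e c)
    continuous_p := Y.continuous_p.comp E.continuous
    surjective_p := Y.surjective_p.comp e.surjective
    act g c h := e.symm (Y.act g (e c) h)
    p_act g c h := by rw [e.apply_symm_apply, Y.p_act]
    unit_act c := by rw [Y.unit_act, e.symm_apply_apply]
    mul_act g h k c hc := congrArg e.symm <| (Y.mul_act g h k (e c) hc).trans <|
      Y.act_congr rfl (e.apply_symm_apply _).symm _ _
    continuous_act := E.symm.continuous.comp <| Y.continuous_act.comp
      (f := fun q : {q : Arr X × C // q.1.src = Y.p (e q.2)} =>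
        (⟨(q.1.1, E q.1.2), q.2⟩ : {q : Arr X × Y // q.1.src = Y.p q.2})) (by fun_prop) }

/-- The transported space maps bijectively to the original one. -/
def ofEquivMap : GMap (ofEquiv Y e).toGSpace Y where
  toFun := e
  continuous_toFun := continuous_induced_dom
  p_toFun _ := rfl
  toFun_act _ _ _ := e.apply_symm_apply _

end GSpaceStructure

namespace CompactGSpace

/-- An irreducible space is the closure of the orbits of a section, hence its size is bounded. -/
theorem IsIrreducible.exists_injective [IsEtaleGroupoid X] {Y : CompactGSpace.{u, v, w} X}
    (hY : Y.IsIrreducible) : ∃ j : Y → Filter (Arr X), Function.Injective j := by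
  choose σ hσ using Y.surjective_p
  let o : Arr X → Y := fun g => Y.act g (σ g.src) (hσ _).symm
  have hfull := isFull_closure_saturation (S := range σ) fun x => ⟨_, ⟨x, rfl⟩, hσ x⟩
  have hsub : Y.saturation (range σ) ⊆ range o := by
    rintro _ ⟨g, _, h, ⟨x, rfl⟩, rfl⟩
    exact ⟨g, Y.act_congr rfl (congrArg σ (h.trans (hσ x))) _ _⟩
  have ho : DenseRange o := fun y => closure_mono hsub <| by
    rw [hY _ hfull.isClosed hfull.isInvariant hfull.image_p]
    trivial
  -- As `o` has dense range, the pulled-back neighbourhood filter is proper, and `y` is the unique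
  -- limit of `o` along it.
  refine ⟨fun y => comap o (𝓝 y), fun y z h => ?_⟩
  have : (comap o (𝓝 y)).NeBot := 
    comap_neBot_iff_frequently.2 (mem_closure_iff_frequently.1 (ho y))
  have hz : Tendsto o (comap o (𝓝 y)) (𝓝 z) := by
    rw [show comap o (𝓝 y) = comap o (𝓝 z) from h]
    exact tendsto_comap
  exact tendsto_nhds_unique tendsto_comap hz

/-- The fibre product over the unit space of a family of compact `G`-spaces. -/
def fibreProduct [CompactSpace X] [T2Space X] [IsEtaleGroupoid X] {ι : Type w'}
    (Y : ι → CompactGSpace.{u, v, w} X) : CompactGSpace.{u, v, max u w w'} X where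
  -- The separate base coordinate makes the empty product equal to `X`.
  carrier := {q : X × (∀ i, Y i) // ∀ i, (Y i).p (q.2 i) = q.1}
  compact := by
    refine isCompact_iff_compactSpace.1 (IsClosed.isCompact ?_)
    have : {q : X × (∀ i, Y i) | ∀ i, (Y i).p (q.2 i) = q.1} =
      ⋂ i, {q : X × (∀ i, Y i) | (Y i).p (q.2 i) = q.1} := by ext; simp
    change IsClosed {q : X × (∀ i, Y i) | ∀ i, (Y i).p (q.2 i) = q.1}
    rw [this]
    exact isClosed_iInter fun i => isClosed_eq
      ((Y i).continuous_p.comp ((continuous_apply i).comp continuous_snd)) continuous_fst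
  p q := q.1.1
  continuous_p := continuous_fst.comp continuous_subtype_val
  surjective_p x := by
    choose y hy using fun i => (Y i).surjective_p x
    exact ⟨⟨(x, y), hy⟩, rfl⟩
  act g q h := ⟨(g.tgt, fun i => (Y i).act g (q.1.2 i) (h.trans (q.2 i).symm)),
    fun i => (Y i).p_act _ _ _⟩
  p_act _ _ _ := rfl
  unit_act q := Subtype.ext <| Prod.ext rfl <| funext fun i =>
    ((Y i).act_congr (congrArg Arr.unit (q.2 i).symm) rfl _ rfl).trans ((Y i).unit_act _)
  mul_act g h e q hq := Subtype.ext <| Prod.ext rfl <| funext fun i => (Y i).mul_act g h e _ _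
  continuous_act := by
    refine Continuous.subtype_mk (Continuous.prodMk ?_ (continuous_pi fun i => ?_)) _
    · exact (IsEtaleGroupoid.isLocalHomeomorph_tgt (X := X)).continuous.comp
        (continuous_fst.comp continuous_subtype_val)
    · refine (Y i).continuous_act.comp (f := fun q : {q : Arr X × {q : X × (∀ i, Y i) //
        ∀ i, (Y i).p (q.2 i) = q.1} // q.1.src = q.2.1.1} => (⟨(q.1.1, q.1.2.1.2 i),
          q.2.trans (q.1.2.2 i).symm⟩ : {q : Arr X × Y i // q.1.src = (Y i).p q.2})) ?_
      fun_prop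

/-- The projections of a fibre product. -/
def fibreProductProj [CompactSpace X] [T2Space X] [IsEtaleGroupoid X] {ι : Type w'}
    (Y : ι → CompactGSpace.{u, v, w} X) (i : ι) : GMap (fibreProduct Y) (Y i) where
  toFun q := q.1.2 i
  continuous_toFun :=
    (continuous_apply i).comp (continuous_snd.comp continuous_subtype_val)
  p_toFun q := q.2 i
  toFun_act _ _ _ := rfl

end CompactGSpace

end

/-! ### Construction and uniqueness of the universal boundary. -/

namespace CompactGSpace

variable (X : Type u) [TopologicalSpace X] [CompactSpace X] [T2Space X] [MeasurableSpace X]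
  [BorelSpace X] [Groupoid.{v} X] [TopologicalSpace (Arr X)] [IsEtaleGroupoid X]

/-- There is a boundary that maps to all boundaries, whatever their universe. -/
theorem exists_isBoundary_forall_nonempty_gMap : ∃ B : CompactGSpace.{u, v, max u v} X,
    B.IsBoundary ∧ (∀ Y : CompactGSpace.{u, v, w} X, Y.IsBoundary → Nonempty (GMap B Y)) ∧
      ∀ Y : CompactGSpace.{u, v, w'} X, Y.IsBoundary → Nonempty (GMap B Y) := by
  -- Irreducibility is not imposed on the factors; passing to a minimal full subset provides it.
  -- Every boundary, in any universe, has a copy on some such `C`.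
  let I := Σ C : Set (Filter (Arr X)), {S : GSpaceStructure X C // S.toGSpace.IsStronglyProximal}
  let Z : I → CompactGSpace.{u, v, max u v} X := fun i => i.2.1.toGSpace
  obtain ⟨A, -, hA⟩ := (isFull_univ (fibreProduct Z)).exists_minimal
  let π : ∀ i, GMap hA.prop.toGSpace (Z i) := fun i => (fibreProductProj Z i).comp hA.prop.incl
  refine ⟨hA.prop.toGSpace, ⟨isIrreducible_toGSpace hA, isStronglyProximal_of_separating π
    (fun a b hp h => Subtype.ext <| Subtype.ext <| Prod.ext hp <| funext h) fun i => i.2.2⟩,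
    fun Y hY => ?_, fun Y hY => ?_⟩
  all_goals
    obtain ⟨j, hj⟩ := hY.1.exists_injective
    let e := (Equiv.ofInjective j hj).symm
    let φ := GSpaceStructure.ofEquivMap Y e
    exact ⟨φ.comp (π ⟨range j, GSpaceStructure.ofEquiv Y e,
      isStronglyProximal_of_separating (ι := Unit) (fun _ => φ)
        (fun a b _ h => e.injective (h ())) fun _ => hY.2⟩)⟩

variable {X}

/-- Boundaries that map to each other are isomorphic. -/
theorem nonempty_gIso {B : CompactGSpace.{u, v, w} X} {B' : CompactGSpace.{u, v, w'} X}
    (hB : B.IsBoundary) (hB' : B'.IsBoundary) (φ : GMap B B') (ψ : GMap B' B) :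
    Nonempty (GIso B B') :=
  ⟨⟨φ, ψ,
    fun y => congrArg (fun θ => θ.toFun y)
      (GMap.eq_of_isIrreducible hB.1 hB.2 (ψ.comp φ) (GMap.id B)),
    fun y => congrArg (fun θ => θ.toFun y)
      (GMap.eq_of_isIrreducible hB'.1 hB'.2 (φ.comp ψ) (GMap.id B'))⟩⟩

end CompactGSpace

end FurstenbergBoundary

theorem mainTheorem10 {X : Type u} [TopologicalSpace X] [CompactSpace X] [T2Space X]
    [MeasurableSpace X] [BorelSpace X] [CategoryTheory.Groupoid.{v} X]
    [TopologicalSpace (FurstenbergBoundary.Arr X)] [FurstenbergBoundary.IsEtaleGroupoid X] :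
    ∃ B : FurstenbergBoundary.CompactGSpace.{u, v, max u v} X,
      B.IsUniversalBoundary.{u, v, max u v, max u v} ∧
      B.IsUniversalBoundary.{u, v, max u v, w} ∧
      (∀ Y : FurstenbergBoundary.CompactGSpace.{u, v, w} X, Y.IsBoundary →
        ∀ f : B.GMap Y, Function.Surjective f.toFun) ∧
      (∀ B' : FurstenbergBoundary.CompactGSpace.{u, v, w} X,
        B'.IsUniversalBoundary.{u, v, w, max u v} → Nonempty (B.GIso B')) := by
  -- The same `B` must serve its own universe, to receive a map from `B'`, and `Type w`, where `B'`
  -- lives.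
  obtain ⟨B, hB, h, h'⟩ :=
    FurstenbergBoundary.CompactGSpace.exists_isBoundary_forall_nonempty_gMap.{u, v, max u v, w} X
  refine ⟨B, ⟨hB, h⟩, ⟨hB, h'⟩, fun Y hY f => f.surjective hY.1, fun B' hB' => ?_⟩
  obtain ⟨φ⟩ := h' B' hB'.1
  obtain ⟨ψ⟩ := hB'.2 B hB
  exact FurstenbergBoundary.CompactGSpace.nonempty_gIso hB hB'.1 φ ψ
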